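/- For $\nu\in\mathbb R$ let $$J_\nu(z)=\Big(\frac z2\Big)^{\nu}\sum_{m=0}^\infty \frac{(-1)^m}{m!\,\Gamma(\nu+m+1)}\Big(\frac z2\Big)^{2m},\qquad z>0,$$ be the Bessel function of the first kind (with $1/\Gamma=0$ at $0,-1,-2,\dots$). For $c<b$ let $W_{\rm AC}(c,b)$ be the space of real-valued functions $\psi$ that are absolutely continuous on $[c,b]$ with $\psi'\in L^1(c,b)$, with the norm $\|\psi\|_{W_{\rm AC}(c,b)}=\|\psi\|_{L^\infty(c,b)}+\|\psi'\|_{L^1(c,b)}$. Let $\nu\in\mathbb R$, $\beta>-1$ and $0<c<b$. Then there are constants $C>0$ and $\omega_0>0$, depending only on $\nu,\beta,b,c$, such that for all $\omega\ge\omega_0$ and all $\psi\in W_{\rm AC}(c,b)$ the function $x\mapsto(b-x)^\beta J_\nu(\omega x)\psi(x)$ is integrable on $(c,b)$ and $$\Big|\int_c^b (b-x)^\beta J_\nu(\omega x)\,\psi(x)\,dx\Big|\le C\,\|\psi\|_{W_{\rm AC}(c,b)}\;\omega^{-\min\{\beta+\frac32,\,\frac32\}} .$$ -/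

import Mathlib

open MeasureTheory Set

/-- The Bessel function of the first kind `J_ν(z)` of real order `ν` at a real argument `z > 0`,
`J_ν(z) = (z/2)^ν ∑_{m ≥ 0} (-1)^m / (m! Γ(ν + m + 1)) (z/2)^{2m}`.
The reciprocal Gamma function vanishes at `0, -1, -2, …`; this is respected because
`Real.Gamma` takes the value `0` there and `x / 0 = 0`, so negative integer orders are covered. -/
noncomputable def besselJ (ν z : ℝ) : ℝ :=
  (z / 2) ^ ν *
    ∑' m : ℕ, (-1 : ℝ) ^ m / ((m.factorial : ℝ) * Real.Gamma (ν + m + 1)) * (z / 2) ^ (2 * m)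

/-- The space `W_AC(c, d)` (for `c < d`) of functions that are absolutely continuous on `[c, d]`
and whose (almost everywhere defined) derivative is in `L¹(c, d)`. -/
def WAC (c d : ℝ) : Set (ℝ → ℝ) :=
  {ψ | AbsolutelyContinuousOnInterval ψ c d ∧ MemLp (deriv ψ) 1 (volume.restrict (Ioo c d))}

/-- The norm `‖ψ‖_{L^∞(c, d)} + ‖ψ'‖_{L¹(c, d)}` of `W_AC(c, d)`; both terms are finite
for `ψ ∈ W_AC(c, d)`. -/
noncomputable def normWAC (c d : ℝ) (ψ : ℝ → ℝ) : ℝ :=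
  (eLpNorm ψ ⊤ (volume.restrict (Ioo c d))).toReal +
    (eLpNorm (deriv ψ) 1 (volume.restrict (Ioo c d))).toReal

/-! The integral is cut at distance `1 / ω` from the singular endpoint `b`. Since `J_ν(ωx) =
O(ω^(-1/2))` on `[c, b]` (`exists_abs_besselJ_le`), the short piece costs `ω^(-1/2)` times the mass
`ω^(-β-1) / (β+1)` of the weight there. On `[c, b - 1/ω]` one integrates by parts
(`abs_integral_mul_besselJ_le`): up to a term of relative size `1/(ωx)`, `J_ν(ωx)` is the derivative
of `J_{ν+1}(ωx)/ω`, which is `O(ω^(-3/2))`. What remains is the supremum and total variation of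
`(b-x)^β ψ`; the weight is monotone, so both are at most a constant times `ω^(-min(β,0)) ‖ψ‖`. The
decay of `J_ν` comes from an energy estimate (`exists_sq_besselJ_add_sq_le`) for the first-order
system satisfied by `(J_ν, J_{ν+1})`, which is itself read off the power series; no asymptotic
expansion is needed. -/

/-! ### Power series, recurrences and derivatives of `J_ν`. -/

/-- Coefficients of the entire function `t ↦ (√t)^(-ν) J_ν(2 √t)`. -/
noncomputable def besselCoeff (ν : ℝ) (m : ℕ) : ℝ :=
  (-1 : ℝ) ^ m / ((m.factorial : ℝ) * Real.Gamma (ν + m + 1))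

/-- The entire function `t ↦ (√t)^(-ν) J_ν(2 √t)`. -/
noncomputable def besselSeries (ν t : ℝ) : ℝ := ∑' m : ℕ, besselCoeff ν m * t ^ m

theorem besselJ_eq_rpow_mul_besselSeries (ν z : ℝ) :
    besselJ ν z = (z / 2) ^ ν * besselSeries ν ((z / 2) ^ 2) := by
  simp only [besselJ, besselSeries, besselCoeff, pow_mul]

theorem succ_mul_besselCoeff_succ (ν : ℝ) (m : ℕ) :
    (m + 1) * besselCoeff ν (m + 1) = -besselCoeff (ν + 1) m := by
  have h : ν + ((m + 1 : ℕ) : ℝ) + 1 = ν + 1 + m + 1 := by push_cast; ring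
  have hm : (m : ℝ) + 1 ≠ 0 := by positivity
  have hf : (m.factorial : ℝ) ≠ 0 := by positivity
  rw [besselCoeff, besselCoeff, h, Nat.factorial_succ, pow_succ]
  push_cast
  by_cases hG : Real.Gamma (ν + 1 + m + 1) = 0
  · simp [hG]
  · field_simp

/-- The functional equation of Gamma. At its poles the convention `1 / Γ = 0` makes both sides
vanish, so no order is excluded. -/
theorem besselCoeff_eq_mul (ν : ℝ) (m : ℕ) :
    besselCoeff ν m = (ν + m + 1) * besselCoeff (ν + 1) m := by
  have h : ν + 1 + m + 1 = (ν + m + 1) + 1 := by ring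
  rw [besselCoeff, besselCoeff, h]
  by_cases h0 : ν + m + 1 = 0
  · simp [h0]
  · rw [Real.Gamma_add_one h0]
    by_cases hG : Real.Gamma (ν + m + 1) = 0
    · simp [hG]
    · have hf : (m.factorial : ℝ) ≠ 0 := by positivity
      field_simp

theorem besselCoeff_succ_rec (ν : ℝ) (m : ℕ) :
    (m + 1) * (ν + m + 1) * besselCoeff ν (m + 1) = -besselCoeff ν m := by
  have h1 := succ_mul_besselCoeff_succ ν m
  have h2 := besselCoeff_eq_mul ν m
  linear_combination (ν + m + 1) * h1 + h2

theorem summable_besselCoeff_mul_pow (ν t : ℝ) : Summable fun m => besselCoeff ν m * t ^ m := by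
  refine summable_of_ratio_norm_eventually_le (r := 1 / 2) (by norm_num) ?_
  filter_upwards [Filter.eventually_ge_atTop ⌈|ν| + 2 * |t|⌉₊] with m hm
  have hm' : |ν| + 2 * |t| ≤ m := Nat.ceil_le.mp hm
  have hrec := congrArg abs (besselCoeff_succ_rec ν m)
  have hν := neg_abs_le ν
  have ht := abs_nonneg t
  have hm0 : (0 : ℝ) ≤ m := by positivity
  rw [abs_mul, abs_mul, abs_neg, abs_of_nonneg (by linarith : (0 : ℝ) ≤ m + 1),
    abs_of_nonneg (by linarith : (0 : ℝ) ≤ ν + m + 1)] at hrec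
  have hle : 2 * |t| ≤ (m + 1) * (ν + m + 1) := by nlinarith
  simp only [norm_mul, norm_pow, Real.norm_eq_abs]
  rw [← hrec, pow_succ]
  have := mul_le_mul_of_nonneg_right hle
    (mul_nonneg (abs_nonneg (besselCoeff ν (m + 1))) (pow_nonneg ht m))
  linarith

theorem hasDerivAt_besselSeries (ν t : ℝ) :
    HasDerivAt (besselSeries ν) (-besselSeries (ν + 1) t) t := by
  set R : ℝ := |t| + 1 with hR
  have hR0 : 0 ≤ R := by positivity
  have hu : Summable fun m : ℕ => |besselCoeff ν m| * (m * R ^ (m - 1)) := by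
    -- Without its zero first term, the majorant is the absolute series of order `ν + 1` at `R`.
    rw [← summable_nat_add_iff 1]
    refine (summable_besselCoeff_mul_pow (ν + 1) R).abs.congr fun m => ?_
    have h := congrArg abs (succ_mul_besselCoeff_succ ν m)
    rw [abs_neg, abs_mul, abs_of_nonneg (by positivity : (0 : ℝ) ≤ m + 1)] at h
    rw [abs_mul, ← h, abs_of_nonneg (pow_nonneg hR0 m)]
    push_cast
    ring
  have hder := hasDerivAt_tsum_of_isPreconnected (𝕜 := ℝ)
    (g := fun (m : ℕ) (y : ℝ) => besselCoeff ν m * y ^ m)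
    (g' := fun (m : ℕ) (y : ℝ) => besselCoeff ν m * (m * y ^ (m - 1))) (y₀ := t) (y := t)
    hu (Metric.isOpen_ball (x := (0 : ℝ)) (ε := R)) (convex_ball (0 : ℝ) R).isPreconnected
    (fun m y _ => (hasDerivAt_pow m y).const_mul _)
    (fun m y hy => by
      rw [mem_ball_zero_iff, Real.norm_eq_abs] at hy
      simp only [norm_mul, norm_pow, Real.norm_eq_abs, Nat.abs_cast]
      gcongr)
    (by simp [hR]) (summable_besselCoeff_mul_pow ν t) (by simp [hR])
  have hs : Summable fun m : ℕ => besselCoeff ν m * (m * t ^ (m - 1)) := by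
    refine Summable.of_norm_bounded hu fun m => ?_
    simp only [norm_mul, norm_pow, Real.norm_eq_abs, Nat.abs_cast]
    gcongr
    linarith
  refine hder.congr_deriv ?_
  rw [hs.tsum_eq_zero_add, besselSeries, ← tsum_neg]
  simp only [Nat.cast_zero, zero_mul, mul_zero, zero_add]
  refine tsum_congr fun m => ?_
  have h := succ_mul_besselCoeff_succ ν m
  push_cast
  linear_combination t ^ m * h

/-- Coefficientwise: split the factor `ν + m + 1` into `ν + 1` and `m`; the factor `m` shifts the
index and raises the order once more. -/
theorem besselSeries_eq_sub (ν t : ℝ) :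
    besselSeries ν t = (ν + 1) * besselSeries (ν + 1) t - t * besselSeries (ν + 2) t := by
  have h1 := summable_besselCoeff_mul_pow ν t
  have h2 := summable_besselCoeff_mul_pow (ν + 1) t
  have h3 := summable_besselCoeff_mul_pow (ν + 2) t
  have h2' := (summable_nat_add_iff 1).2 h2
  have h0 := besselCoeff_eq_mul ν 0
  rw [besselSeries, besselSeries, besselSeries, h1.tsum_eq_zero_add, h2.tsum_eq_zero_add, mul_add,
    add_sub_assoc, ← tsum_mul_left, ← tsum_mul_left, ← (h2'.mul_left _).tsum_sub (h3.mul_left _)]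
  congr 1
  · rw [h0]; push_cast; ring
  · refine tsum_congr fun m => ?_
    have e1 := besselCoeff_eq_mul ν (m + 1)
    have e2 := succ_mul_besselCoeff_succ (ν + 1) m
    rw [show ν + 1 + 1 = ν + 2 by ring] at e2
    push_cast at e1
    linear_combination t ^ (m + 1) * e1 + t ^ (m + 1) * e2

theorem besselJ_add_two (ν : ℝ) {z : ℝ} (hz : 0 < z) :
    besselJ (ν + 2) z = 2 * (ν + 1) / z * besselJ (ν + 1) z - besselJ ν z := by
  have hz2 : 0 < z / 2 := by positivity
  simp only [besselJ_eq_rpow_mul_besselSeries]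
  rw [besselSeries_eq_sub ν, Real.rpow_add hz2, Real.rpow_add hz2, Real.rpow_one,
    Real.rpow_ofNat]
  field_simp
  ring

theorem hasDerivAt_besselJ (ν : ℝ) {z : ℝ} (hz : 0 < z) :
    HasDerivAt (besselJ ν) (ν / z * besselJ ν z - besselJ (ν + 1) z) z := by
  have hz2 : 0 < z / 2 := by positivity
  have hd : HasDerivAt (fun y : ℝ => y / 2) (1 / 2) z := (hasDerivAt_id z).div_const 2
  have h1 := hd.rpow_const (p := ν) (Or.inl hz2.ne')
  have h2 := (hasDerivAt_besselSeries ν ((z / 2) ^ 2)).comp z (hd.pow 2)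
  have h := h1.mul h2
  have hfun : besselJ ν = (fun y : ℝ => (y / 2) ^ ν) *
      (besselSeries ν ∘ ((fun y : ℝ => y / 2) ^ 2)) := by
    ext y; simp [besselJ_eq_rpow_mul_besselSeries]
  rw [hfun]
  refine h.congr_deriv ?_
  simp only [Pi.mul_apply, Function.comp, Pi.pow_apply]
  rw [besselJ_eq_rpow_mul_besselSeries, Real.rpow_sub hz2, Real.rpow_add hz2, Real.rpow_one]
  field_simp
  ring

/-- Together with `hasDerivAt_besselJ` this closes the system for `(J_ν, J_{ν+1})`: a rotation plus
diagonal terms of size `1/z`. -/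
theorem hasDerivAt_besselJ_add_one (ν : ℝ) {z : ℝ} (hz : 0 < z) :
    HasDerivAt (besselJ (ν + 1)) (besselJ ν z - (ν + 1) / z * besselJ (ν + 1) z) z := by
  refine (hasDerivAt_besselJ (ν + 1) hz).congr_deriv ?_
  rw [show ν + 1 + 1 = ν + 2 by ring, besselJ_add_two ν hz]
  ring

theorem continuousOn_besselJ (ν : ℝ) : ContinuousOn (besselJ ν) (Ioi 0) := fun _ hz =>
  (hasDerivAt_besselJ ν hz).continuousAt.continuousWithinAt

theorem contDiffOn_besselJ (ν : ℝ) : ContDiffOn ℝ 1 (besselJ ν) (Ioi 0) := by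
  rw [show (1 : WithTop ℕ∞) = 0 + 1 by simp, contDiffOn_succ_iff_deriv_of_isOpen isOpen_Ioi]
  refine ⟨fun z hz => (hasDerivAt_besselJ ν hz).differentiableAt.differentiableWithinAt,
    by simp, ?_⟩
  rw [contDiffOn_zero]
  refine ContinuousOn.congr (f := fun z => ν / z * besselJ ν z - besselJ (ν + 1) z) ?_
    fun z hz => (hasDerivAt_besselJ ν hz).deriv
  exact ((continuousOn_const.div continuousOn_id fun z hz => (ne_of_gt hz)).mul
    (continuousOn_besselJ ν)).sub (continuousOn_besselJ (ν + 1))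

/-! ### Decay at infinity. -/

/-- `J_ν(z)² + J_{ν+1}(z)² = O(1 / z)`: the energy `G = z (A² + B²) - (2ν + 1) A B` with `A = J_ν`,
`B = J_{ν+1}` satisfies `G' ≤ |2ν + 1| z⁻² G` for large `z`. -/
theorem exists_sq_besselJ_add_sq_le (ν : ℝ) : ∃ M z₀ : ℝ, 0 < M ∧ 0 < z₀ ∧ ∀ z, z₀ ≤ z →
    z * (besselJ ν z ^ 2 + besselJ (ν + 1) z ^ 2) ≤ M := by
  set k : ℝ := |2 * ν + 1| with hk
  have hk0 : 0 ≤ k := abs_nonneg _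
  set G : ℝ → ℝ := fun z => z * (besselJ ν z ^ 2 + besselJ (ν + 1) z ^ 2) -
    (2 * ν + 1) * (besselJ ν z * besselJ (ν + 1) z) with hG
  -- For `z ≥ k + 1` the cross term is at most half of the main term.
  have hGle : ∀ z, k + 1 ≤ z → z * (besselJ ν z ^ 2 + besselJ (ν + 1) z ^ 2) ≤ 2 * G z := by
    intro z hz
    have hab : (2 * ν + 1) * (besselJ ν z * besselJ (ν + 1) z) ≤
        k * |besselJ ν z * besselJ (ν + 1) z| := by
      rw [hk, ← abs_mul]; exact le_abs_self _
    have h2 : 2 * |besselJ ν z * besselJ (ν + 1) z| ≤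
        besselJ ν z ^ 2 + besselJ (ν + 1) z ^ 2 := by
      have := two_mul_le_add_sq |besselJ ν z| |besselJ (ν + 1) z|
      rw [abs_mul]; simpa [mul_assoc] using this
    have h3 : 0 ≤ besselJ ν z ^ 2 + besselJ (ν + 1) z ^ 2 := by positivity
    simp only [hG]
    nlinarith
  -- The cross term in `G` cancels the contribution `(2ν+1)(A² - B²)` of the main term, leaving `G'
  -- = (2ν+1) A B / z`; `exp (k / z)` is the integrating factor that absorbs it.
  have hder : ∀ z, 0 < z → HasDerivAt (fun z => G z * Real.exp (k / z))
      ((((2 * ν + 1) * (besselJ ν z * besselJ (ν + 1) z) / z) - k / z ^ 2 * G z) *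
        Real.exp (k / z)) z := by
    intro z hz
    have hA := hasDerivAt_besselJ ν hz
    have hB := hasDerivAt_besselJ_add_one ν hz
    have hE : HasDerivAt (fun z => Real.exp (k / z)) (Real.exp (k / z) * (-k / z ^ 2)) z := by
      refine HasDerivAt.exp ?_
      exact ((hasDerivAt_const z k).fun_div (hasDerivAt_id' z) hz.ne').congr_deriv (by ring)
    have hGd := (((hasDerivAt_id z).mul ((hA.pow 2).add (hB.pow 2))).sub
      ((hA.mul hB).const_mul (2 * ν + 1))).mul hE
    refine hGd.congr_deriv ?_
    simp only [hG, Pi.add_apply, Pi.mul_apply, Pi.pow_apply, Pi.sub_apply, id]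
    field_simp
    ring
  have hanti : AntitoneOn (fun z => G z * Real.exp (k / z)) (Ici (k + 1)) := by
    refine antitoneOn_of_deriv_nonpos (convex_Ici _)
      (fun z hz => (hder z (by have : k + 1 ≤ z := hz; linarith)).continuousAt.continuousWithinAt)
      (fun z hz => ?_) (fun z hz => ?_)
    all_goals
      rw [interior_Ici] at hz
      have hz1 : k + 1 < z := hz
      have hz0 : 0 < z := by linarith
    · exact (hder z hz0).differentiableAt.differentiableWithinAt
    · rw [(hder z hz0).deriv]
      refine mul_nonpos_of_nonpos_of_nonneg ?_ (Real.exp_pos _).le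
      have hab : (2 * ν + 1) * (besselJ ν z * besselJ (ν + 1) z) ≤
          k * |besselJ ν z * besselJ (ν + 1) z| := by
        rw [hk, ← abs_mul]; exact le_abs_self _
      have h2 : 2 * |besselJ ν z * besselJ (ν + 1) z| ≤
          besselJ ν z ^ 2 + besselJ (ν + 1) z ^ 2 := by
        have := two_mul_le_add_sq |besselJ ν z| |besselJ (ν + 1) z|
        rw [abs_mul]; simpa [mul_assoc] using this
      have h3 := hGle z hz1.le
      have h4 : z * ((2 * ν + 1) * (besselJ ν z * besselJ (ν + 1) z)) ≤ k * G z := by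
        calc z * ((2 * ν + 1) * (besselJ ν z * besselJ (ν + 1) z))
            ≤ z * (k * |besselJ ν z * besselJ (ν + 1) z|) := by gcongr
          _ = k * (z * |besselJ ν z * besselJ (ν + 1) z|) := by ring
          _ ≤ k * G z := by
            refine mul_le_mul_of_nonneg_left ?_ hk0
            nlinarith
      have h5 : (2 * ν + 1) * (besselJ ν z * besselJ (ν + 1) z) / z - k / z ^ 2 * G z =
          (z * ((2 * ν + 1) * (besselJ ν z * besselJ (ν + 1) z)) - k * G z) / z ^ 2 := by
        field_simp
      rw [h5]
      exact div_nonpos_of_nonpos_of_nonneg (by linarith) (by positivity)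
  refine ⟨2 * |G (k + 1) * Real.exp (k / (k + 1))| + 1, k + 1, by positivity, by positivity,
    fun z hz => ?_⟩
  have h1 := hanti (mem_Ici.2 le_rfl) (mem_Ici.2 hz) hz
  have h2 := hGle z hz
  have hz0 : 0 < z := by linarith
  have hG0 : 0 ≤ G z := by
    have : 0 ≤ z * (besselJ ν z ^ 2 + besselJ (ν + 1) z ^ 2) := by positivity
    linarith
  have h3 : G z ≤ G z * Real.exp (k / z) :=
    le_mul_of_one_le_right hG0 (Real.one_le_exp (by positivity))
  have h4 := le_abs_self (G (k + 1) * Real.exp (k / (k + 1)))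
  simp only at h1
  linarith

/-- `J_ν(z)` and `J_{ν+1}(z)` are `O(z^(-1/2))`. -/
theorem exists_abs_besselJ_le (ν : ℝ) : ∃ M z₀ : ℝ, 0 < M ∧ 0 < z₀ ∧ ∀ z, z₀ ≤ z →
    |besselJ ν z| ≤ M * z ^ (-(1 / 2) : ℝ) ∧ |besselJ (ν + 1) z| ≤ M * z ^ (-(1 / 2) : ℝ) := by
  obtain ⟨M, z₀, hM, hz₀, h⟩ := exists_sq_besselJ_add_sq_le ν
  have key : ∀ z x y : ℝ, 0 < z → z * (x ^ 2 + y ^ 2) ≤ M → |x| ≤ √M * z ^ (-(1 / 2) : ℝ) := by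
    intro z x y hz hxy
    rw [Real.rpow_neg hz.le, ← Real.sqrt_eq_rpow, ← div_eq_mul_inv,
      ← Real.sqrt_div' _ hz.le]
    refine Real.abs_le_sqrt ?_
    rw [le_div_iff₀ hz]
    nlinarith [mul_nonneg hz.le (sq_nonneg y)]
  refine ⟨√M, z₀, Real.sqrt_pos.2 hM, hz₀, fun z hz => ?_⟩
  have hz0 : 0 < z := by linarith
  exact ⟨key z _ _ hz0 (h z hz), key z _ _ hz0 (by rw [add_comm]; exact h z hz)⟩

/-! ### Integration by parts and total variation. -/

/-- A bound for the integral against a derivative, by parts. -/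
theorem AbsolutelyContinuousOnInterval.abs_integral_mul_deriv_le {φ V : ℝ → ℝ} {a s P K : ℝ}
    (has : a ≤ s) (hφ : AbsolutelyContinuousOnInterval φ a s)
    (hV : AbsolutelyContinuousOnInterval V a s) (hP : ∀ x ∈ Icc a s, |φ x| ≤ P)
    (hK : ∀ x ∈ Icc a s, |V x| ≤ K) :
    |∫ x in a..s, φ x * deriv V x| ≤ K * (2 * P + ∫ x in a..s, |deriv φ x|) := by
  have ha : a ∈ Icc a s := left_mem_Icc.2 has
  have hs : s ∈ Icc a s := right_mem_Icc.2 has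
  have hP0 : 0 ≤ P := (abs_nonneg _).trans (hP a ha)
  rw [hφ.integral_mul_deriv_eq_deriv_mul hV]
  have h1 : |φ s * V s| ≤ P * K := by
    rw [abs_mul]; exact mul_le_mul (hP s hs) (hK s hs) (abs_nonneg _) hP0
  have h2 : |φ a * V a| ≤ P * K := by
    rw [abs_mul]; exact mul_le_mul (hP a ha) (hK a ha) (abs_nonneg _) hP0
  have h3 : |∫ x in a..s, deriv φ x * V x| ≤ ∫ x in a..s, |deriv φ x| * K := by
    refine intervalIntegral.norm_integral_le_of_norm_le (f := fun x => deriv φ x * V x)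
      (g := fun x => |deriv φ x| * K) has (Filter.Eventually.of_forall fun x hx => ?_)
      (hφ.intervalIntegrable_deriv.abs.mul_const K)
    rw [norm_mul]
    exact mul_le_mul_of_nonneg_left (hK x (Ioc_subset_Icc_self hx)) (abs_nonneg _)
  rw [intervalIntegral.integral_mul_const] at h3
  have h4 := abs_sub (φ s * V s - φ a * V a) (∫ x in a..s, deriv φ x * V x)
  have h5 := abs_sub (φ s * V s) (φ a * V a)
  linarith

/-- The total variation of a product with a monotone factor `g`, whose monotonicity is expressed by
a constant sign `σ` of its derivative. -/
theorem AbsolutelyContinuousOnInterval.integral_abs_deriv_mul_le {g ψ : ℝ → ℝ} {a s Q N σ : ℝ}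
    (has : a ≤ s) (hg : AbsolutelyContinuousOnInterval g a s)
    (hψ : AbsolutelyContinuousOnInterval ψ a s) (hg0 : ∀ x ∈ Icc a s, 0 ≤ g x)
    (hgQ : ∀ x ∈ Icc a s, g x ≤ Q) (hN : ∀ x ∈ Icc a s, |ψ x| ≤ N) (hσ : |σ| ≤ 1)
    (hsign : ∀ x ∈ Icc a s, |deriv g x| = σ * deriv g x) :
    ∫ x in a..s, |deriv (fun y => g y * ψ y) x| ≤ N * Q + Q * ∫ x in a..s, |deriv ψ x| := by
  have ha : a ∈ Icc a s := left_mem_Icc.2 has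
  have hs : s ∈ Icc a s := right_mem_Icc.2 has
  have hN0 : 0 ≤ N := (abs_nonneg _).trans (hN a ha)
  -- The constant sign makes the variation telescope to `σ (g s - g a)`, and `g` takes values in
  -- `[0, Q]`.
  have hg' : ∫ x in a..s, |deriv g x| ≤ Q := by
    have : ∫ x in a..s, |deriv g x| = σ * (g s - g a) := by
      rw [← hg.integral_deriv_eq_sub, ← intervalIntegral.integral_const_mul]
      refine intervalIntegral.integral_congr fun x hx => ?_
      rw [uIcc_of_le has] at hx
      exact hsign x hx
    rw [this]
    have h1 : |g s - g a| ≤ Q := by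
      rw [abs_le]
      constructor <;> linarith [hg0 a ha, hg0 s hs, hgQ a ha, hgQ s hs]
    calc σ * (g s - g a) ≤ |σ| * |g s - g a| := by rw [← abs_mul]; exact le_abs_self _
      _ ≤ 1 * Q := mul_le_mul hσ h1 (abs_nonneg _) zero_le_one
      _ = Q := one_mul Q
  have hint1 := hg.intervalIntegrable_deriv.abs.const_mul N
  have hint2 := hψ.intervalIntegrable_deriv.abs.const_mul Q
  calc ∫ x in a..s, |deriv (fun y => g y * ψ y) x|
      ≤ ∫ x in a..s, (N * |deriv g x| + Q * |deriv ψ x|) := by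
        refine intervalIntegral.integral_mono_ae_restrict has
          (hg.fun_mul hψ).intervalIntegrable_deriv.abs (hint1.add hint2) ?_
        rw [Filter.EventuallyLE, ae_restrict_iff' measurableSet_Icc]
        filter_upwards [hg.ae_differentiableAt, hψ.ae_differentiableAt] with x h1 h2 hx
        rw [uIcc_of_le has] at h1 h2
        rw [deriv_fun_mul (h1 hx) (h2 hx)]
        refine (abs_add_le _ _).trans ?_
        rw [abs_mul, abs_mul, abs_of_nonneg (hg0 x hx), mul_comm]
        exact add_le_add (mul_le_mul_of_nonneg_right (hN x hx) (abs_nonneg _))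
          (mul_le_mul_of_nonneg_right (hgQ x hx) (abs_nonneg _))
    _ = N * (∫ x in a..s, |deriv g x|) + Q * ∫ x in a..s, |deriv ψ x| := by
        rw [intervalIntegral.integral_add hint1 hint2, intervalIntegral.integral_const_mul,
          intervalIntegral.integral_const_mul]
    _ ≤ N * Q + Q * ∫ x in a..s, |deriv ψ x| := by gcongr

/-! ### The norm of `W_AC` and the endpoint weight. -/

theorem abs_le_eLpNorm_top_toReal {ψ : ℝ → ℝ} {c b : ℝ} (hcb : c < b)
    (hψ : ContinuousOn ψ (Icc c b)) {x : ℝ} (hx : x ∈ Icc c b) :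
    |ψ x| ≤ (eLpNorm ψ ⊤ (volume.restrict (Ioo c b))).toReal := by
  obtain ⟨D, hD⟩ := isCompact_Icc.exists_bound_of_continuousOn hψ
  have hfin : eLpNorm ψ ⊤ (volume.restrict (Ioo c b)) ≠ ⊤ := by
    refine (lt_of_le_of_lt (eLpNormEssSup_le_of_ae_bound (C := D) ?_) ENNReal.ofReal_lt_top).ne
    filter_upwards [ae_restrict_mem measurableSet_Ioo] with y hy
    exact hD y (Ioo_subset_Icc_self hy)
  set N := (eLpNorm ψ ⊤ (volume.restrict (Ioo c b))).toReal with hN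
  have hae : ∀ᵐ y ∂(volume.restrict (Icc c b)), |ψ y| ≤ N := by
    rw [← restrict_Ioo_eq_restrict_Icc]
    filter_upwards [ae_le_eLpNormEssSup (f := ψ) (μ := volume.restrict (Ioo c b))] with y hy
    rw [← eLpNorm_exponent_top] at hy
    simpa only [toReal_enorm, Real.norm_eq_abs] using ENNReal.toReal_mono hfin hy
  -- Continuous functions equal almost everywhere agree on all of `[c, b]`, endpoints included;
  -- comparing `|ψ|` with its truncation at `N` makes the bound pointwise.
  have heq := Measure.eqOn_Icc_of_ae_eq volume hcb.ne (f := fun y => min |ψ y| N)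
    (g := fun y => |ψ y|) (by filter_upwards [hae] with y hy; exact min_eq_left hy)
    (hψ.abs.inf continuousOn_const) hψ.abs hx
  exact min_eq_left_iff.1 heq

theorem integral_abs_deriv_eq_eLpNorm_toReal {ψ : ℝ → ℝ} {c b : ℝ} (hcb : c ≤ b)
    (h : MemLp (deriv ψ) 1 (volume.restrict (Ioo c b))) :
    ∫ x in c..b, |deriv ψ x| = (eLpNorm (deriv ψ) 1 (volume.restrict (Ioo c b))).toReal := by
  rw [intervalIntegral.integral_of_le hcb, integral_Ioc_eq_integral_Ioo,
    eLpNorm_one_eq_lintegral_enorm, ← integral_norm_eq_lintegral_enorm h.1]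
  simp only [Real.norm_eq_abs]

theorem intervalIntegrable_sub_rpow {β : ℝ} (hβ : -1 < β) (b c : ℝ) :
    IntervalIntegrable (fun x => (b - x) ^ β) volume c b := by
  have := (intervalIntegral.intervalIntegrable_rpow' (a := b - c) (b := 0) hβ).comp_sub_left b
  simpa using this

theorem integral_sub_rpow {β : ℝ} (hβ : -1 < β) (b s : ℝ) :
    ∫ x in s..b, (b - x) ^ β = (b - s) ^ (β + 1) / (β + 1) := by
  rw [intervalIntegral.integral_comp_sub_left (fun x => x ^ β), integral_rpow (Or.inl hβ)]
  simp [Real.zero_rpow (by linarith : β + 1 ≠ 0)]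

/-! ### The oscillatory integral and the final estimate. -/

/-- Integration by parts against `V x = J_{ν+1}(ωx)/ω`. The defect `(ν+1)/(ωx) J_{ν+1}(ωx)` between
`J_ν(ωx)` and `V'` carries its own factor `1/ω`, as `x ≥ c > 0`, and yields the `|ν + 1|` term. -/
theorem abs_integral_mul_besselJ_le {ν c s ω P K : ℝ} {φ : ℝ → ℝ} (hc : 0 < c) (hcs : c ≤ s)
    (hω : 0 < ω) (hφ : AbsolutelyContinuousOnInterval φ c s) (hP : ∀ x ∈ Icc c s, |φ x| ≤ P)
    (hK : ∀ x ∈ Icc c s, |besselJ (ν + 1) (ω * x)| ≤ K) :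
    |∫ x in c..s, φ x * besselJ ν (ω * x)| ≤
      K / ω * (2 * P + (∫ x in c..s, |deriv φ x|) + |ν + 1| * (s - c) / c * P) := by
  have hcm : c ∈ Icc c s := left_mem_Icc.2 hcs
  have hP0 : 0 ≤ P := (abs_nonneg _).trans (hP c hcm)
  have hK0 : 0 ≤ K := (abs_nonneg _).trans (hK c hcm)
  have hpos : ∀ x ∈ Icc c s, 0 < x := fun x hx => hc.trans_le hx.1
  set V : ℝ → ℝ := fun x => ω⁻¹ * besselJ (ν + 1) (ω * x) with hV
  have hmaps : MapsTo (fun x => ω * x) (uIcc c s) (Ioi 0) := fun x hx => by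
    rw [uIcc_of_le hcs] at hx
    exact mul_pos hω (hpos x hx)
  have hVac : AbsolutelyContinuousOnInterval V c s :=
    (contDiffOn_const.mul ((contDiffOn_besselJ (ν + 1)).comp
      (contDiff_const.mul contDiff_id).contDiffOn hmaps)).absolutelyContinuousOnInterval
  have hVd : ∀ x ∈ Icc c s, deriv V x =
      besselJ ν (ω * x) - (ν + 1) / (ω * x) * besselJ (ν + 1) (ω * x) := fun x hx => by
    have hin : HasDerivAt (fun y => ω * y) ω x := by
      simpa using (hasDerivAt_id x).const_mul ω
    have h := ((hasDerivAt_besselJ_add_one ν (mul_pos hω (hpos x hx))).comp x hin).const_mul ω⁻¹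
    refine h.deriv.trans ?_
    field_simp
  have hVK : ∀ x ∈ Icc c s, |V x| ≤ K / ω := fun x hx => by
    rw [hV, abs_mul, abs_of_pos (inv_pos.2 hω), div_eq_inv_mul]
    exact mul_le_mul_of_nonneg_left (hK x hx) (inv_pos.2 hω).le
  have hφc : ContinuousOn φ (uIcc c s) := hφ.continuousOn
  have hBc : ContinuousOn (fun x => besselJ (ν + 1) (ω * x)) (uIcc c s) :=
    (continuousOn_besselJ (ν + 1)).comp (continuousOn_const.mul continuousOn_id) hmaps
  have hR : IntervalIntegrable (fun x => φ x * ((ν + 1) / (ω * x) * besselJ (ν + 1) (ω * x)))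
      volume c s :=
    (hφc.mul ((continuousOn_const.div (continuousOn_const.mul continuousOn_id)
      fun x hx => (ne_of_gt (hmaps hx))).mul hBc)).intervalIntegrable
  have hsplit : ∫ x in c..s, φ x * besselJ ν (ω * x) = (∫ x in c..s, φ x * deriv V x) +
      ∫ x in c..s, φ x * ((ν + 1) / (ω * x) * besselJ (ν + 1) (ω * x)) := by
    rw [← intervalIntegral.integral_add (hVac.intervalIntegrable_deriv.continuousOn_mul hφc) hR]
    refine intervalIntegral.integral_congr fun x hx => ?_
    rw [uIcc_of_le hcs] at hx
    simp only [hVd x hx]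
    ring
  have h1 := hφ.abs_integral_mul_deriv_le hcs hVac hP hVK
  have h2 : |∫ x in c..s, φ x * ((ν + 1) / (ω * x) * besselJ (ν + 1) (ω * x))| ≤
      P * (|ν + 1| / (ω * c) * K) * |s - c| := by
    refine intervalIntegral.norm_integral_le_of_norm_le_const
      (f := fun x => φ x * ((ν + 1) / (ω * x) * besselJ (ν + 1) (ω * x))) fun x hx => ?_
    rw [uIoc_of_le hcs] at hx
    have hx' := Ioc_subset_Icc_self hx
    have hx0 := hpos x hx'
    rw [norm_mul, norm_mul, norm_div, Real.norm_eq_abs, Real.norm_eq_abs, Real.norm_eq_abs,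
      Real.norm_eq_abs, abs_of_pos (mul_pos hω hx0)]
    gcongr
    · exact hP x hx'
    · exact hx'.1
    · exact hK x hx'
  rw [abs_of_nonneg (sub_nonneg.2 hcs)] at h2
  rw [hsplit]
  refine (abs_add_le _ _).trans ((add_le_add h1 h2).trans_eq ?_)
  field_simp

theorem lemma3p1 (ν β : ℝ) (hβ : -1 < β) (c b : ℝ) (hc : 0 < c) (hcb : c < b) :
    ∃ C ω₀ : ℝ, 0 < C ∧ 0 < ω₀ ∧ ∀ ω : ℝ, ω₀ ≤ ω → ∀ ψ ∈ WAC c b,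
      IntervalIntegrable (fun x => (b - x) ^ β * besselJ ν (ω * x) * ψ x) volume c b ∧
      |∫ x in c..b, (b - x) ^ β * besselJ ν (ω * x) * ψ x| ≤
        C * normWAC c b ψ * ω ^ (-min (β + 3 / 2) (3 / 2)) := by
  obtain ⟨M, z₀, hM, hz₀, hJ⟩ := exists_abs_besselJ_le ν
  have hβ1 : 0 < β + 1 := by linarith
  set e : ℝ := min β 0 with he
  set D : ℝ := max 1 ((b - c) ^ β) with hD
  have hD1 : 1 ≤ D := le_max_left _ _
  set M₁ : ℝ := M * c ^ (-(1 / 2) : ℝ) with hM₁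
  have hM₁0 : 0 < M₁ := mul_pos hM (Real.rpow_pos_of_pos hc _)
  set κ : ℝ := |ν + 1| * (b - c) / c with hκ
  have hbc : 0 < b - c := sub_pos.2 hcb
  have hκ0 : 0 ≤ κ := by positivity
  -- In `3 + κ`, 2 comes from the boundary terms, 1 from the variation, `κ` from the defect; `1 / (β
  -- + 1)` is the tail. The thresholds put `ωx` in the decay range, allow `ω ≥ 1` when comparing
  -- powers, and keep the cut point in `[c, b]`.
  refine ⟨M₁ * (D * (3 + κ) + 1 / (β + 1)), max (z₀ / c) (max 1 (1 / (b - c))), by positivity,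
    lt_max_of_lt_left (by positivity), fun ω hω ψ hψ => ?_⟩
  have hωz : z₀ ≤ ω * c := (div_le_iff₀ hc).1 ((le_max_left _ _).trans hω)
  have hω1 : 1 ≤ ω := (le_max_left _ _).trans ((le_max_right _ _).trans hω)
  have hω2 : 1 / (b - c) ≤ ω := (le_max_right _ _).trans ((le_max_right _ _).trans hω)
  have hω0 : 0 < ω := by linarith
  obtain ⟨hψac, hψL⟩ := hψ
  have hψc : ContinuousOn ψ (uIcc c b) := hψac.continuousOn
  set N : ℝ := (eLpNorm ψ ⊤ (volume.restrict (Ioo c b))).toReal with hN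
  set N' : ℝ := (eLpNorm (deriv ψ) 1 (volume.restrict (Ioo c b))).toReal with hN'
  have hN0 : 0 ≤ N := ENNReal.toReal_nonneg
  have hN'0 : 0 ≤ N' := ENNReal.toReal_nonneg
  have hψN : ∀ x ∈ Icc c b, |ψ x| ≤ N := fun x hx =>
    abs_le_eLpNorm_top_toReal hcb (by rwa [uIcc_of_le hcb.le] at hψc) hx
  have hψN' : ∫ x in c..b, |deriv ψ x| = N' := integral_abs_deriv_eq_eLpNorm_toReal hcb.le hψL
  have hJc : ContinuousOn (fun x => besselJ ν (ω * x)) (uIcc c b) := by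
    refine (continuousOn_besselJ ν).comp (continuousOn_const.mul continuousOn_id) fun x hx => ?_
    rw [uIcc_of_le hcb.le] at hx
    exact mul_pos hω0 (hc.trans_le hx.1)
  have hint : IntervalIntegrable (fun x => (b - x) ^ β * besselJ ν (ω * x) * ψ x) volume c b :=
    ((intervalIntegrable_sub_rpow hβ b c).mul_continuousOn hJc).mul_continuousOn hψc
  refine ⟨hint, ?_⟩
  set K : ℝ := M₁ * ω ^ (-(1 / 2) : ℝ) with hK
  have hK0 : 0 < K := mul_pos hM₁0 (Real.rpow_pos_of_pos hω0 _)
  have hJK : ∀ x, c ≤ x → |besselJ ν (ω * x)| ≤ K ∧ |besselJ (ν + 1) (ω * x)| ≤ K := by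
    intro x hx
    have h := hJ (ω * x) (hωz.trans (by gcongr))
    have hle : M * (ω * x) ^ (-(1 / 2) : ℝ) ≤ K := by
      rw [hK, hM₁, mul_assoc, mul_comm (c ^ _), ← Real.mul_rpow hω0.le hc.le]
      refine mul_le_mul_of_nonneg_left ?_ hM.le
      exact Real.rpow_le_rpow_of_nonpos (by positivity) (by gcongr) (by norm_num)
    exact ⟨h.1.trans hle, h.2.trans hle⟩
  set s : ℝ := b - 1 / ω with hs
  have hωinv : 0 < 1 / ω := by positivity
  have hsb : s < b := by linarith
  have hcs : c ≤ s := by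
    have : 1 / ω ≤ b - c := by
      rw [div_le_iff₀ hω0, mul_comm]; exact (div_le_iff₀ hbc).1 hω2
    linarith
  set Q : ℝ := D * ω ^ (-e) with hQ
  have hQ0 : 0 ≤ Q := by positivity
  -- The weight is largest at `c` if `β ≥ 0` and at the cut `b - 1/ω` if `β ≤ 0`; `D` and `e` cover
  -- both cases at once.
  have hgQ : ∀ x ∈ Icc c s, (b - x) ^ β ≤ Q := by
    intro x hx
    rcases le_total 0 β with h | h
    · rw [hQ, he, min_eq_right h, neg_zero, Real.rpow_zero, mul_one]
      refine le_trans ?_ (le_max_right _ _)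
      exact Real.rpow_le_rpow (by linarith [hx.2]) (by linarith [hx.1]) h
    · rw [hQ, he, min_eq_left h]
      calc (b - x) ^ β ≤ (1 / ω) ^ β :=
            Real.rpow_le_rpow_of_nonpos hωinv (by linarith [hx.2]) h
        _ = ω ^ (-β) := by rw [one_div, Real.inv_rpow hω0.le, Real.rpow_neg hω0.le]
        _ ≤ D * ω ^ (-β) := le_mul_of_one_le_left (by positivity) hD1
  have hg0 : ∀ x ∈ Icc c s, 0 ≤ (b - x) ^ β := fun x hx =>
    Real.rpow_nonneg (by linarith [hx.2]) _
  have hgac : AbsolutelyContinuousOnInterval (fun x => (b - x) ^ β) c s := by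
    refine ContDiffOn.absolutelyContinuousOnInterval ?_
    rw [uIcc_of_le hcs]
    exact (contDiff_const.sub contDiff_id).contDiffOn.rpow_const_of_ne
      fun x hx => ne_of_gt (show 0 < b - x by linarith [hx.2])
  have hsub : Icc c s ⊆ Icc c b := Icc_subset_Icc_right hsb.le
  have hψac' : AbsolutelyContinuousOnInterval ψ c s :=
    hψac.mono (by rwa [uIcc_of_le hcs, uIcc_of_le hcb.le])
  have hgd : ∀ x ∈ Icc c s, deriv (fun x => (b - x) ^ β) x = -β * (b - x) ^ (β - 1) := by
    intro x hx
    have h := ((hasDerivAt_id x).const_sub b).rpow_const (p := β)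
      (Or.inl (ne_of_gt (show 0 < b - x by linarith [hx.2])))
    refine h.deriv.trans ?_
    simp
  have hsign : ∃ σ : ℝ, |σ| ≤ 1 ∧ ∀ x ∈ Icc c s,
      |deriv (fun x => (b - x) ^ β) x| = σ * deriv (fun x => (b - x) ^ β) x := by
    have hp : ∀ x ∈ Icc c s, 0 ≤ (b - x) ^ (β - 1) := fun x hx =>
      Real.rpow_nonneg (by linarith [hx.2]) _
    rcases le_total 0 β with h | h
    · refine ⟨-1, by simp, fun x hx => ?_⟩
      rw [hgd x hx, abs_of_nonpos (by nlinarith [hp x hx]), neg_one_mul]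
    · refine ⟨1, by simp, fun x hx => ?_⟩
      rw [hgd x hx, abs_of_nonneg (by nlinarith [hp x hx]), one_mul]
  obtain ⟨σ, hσ, hsign⟩ := hsign
  have hψN's : ∫ x in c..s, |deriv ψ x| ≤ N' := by
    rw [← hψN']
    exact intervalIntegral.integral_mono_interval le_rfl hcs hsb.le
      (Filter.Eventually.of_forall fun x => abs_nonneg _) hψac.intervalIntegrable_deriv.abs
  have hφ' := hgac.integral_abs_deriv_mul_le hcs hψac' hg0 hgQ (fun x hx => hψN x (hsub hx)) hσ
    hsign
  have hbody := abs_integral_mul_besselJ_le (ν := ν) hc hcs hω0 (hgac.fun_mul hψac')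
    (P := Q * N) (K := K)
    (fun x hx => by
      rw [abs_mul, abs_of_nonneg (hg0 x hx)]
      exact mul_le_mul (hgQ x hx) (hψN x (hsub hx)) (abs_nonneg _) hQ0)
    (fun x hx => (hJK x hx.1).2)
  have htail : |∫ x in s..b, (b - x) ^ β * besselJ ν (ω * x) * ψ x| ≤
      (1 / ω) ^ (β + 1) / (β + 1) * (K * N) := by
    have hle : |∫ x in s..b, (b - x) ^ β * besselJ ν (ω * x) * ψ x| ≤
        ∫ x in s..b, (b - x) ^ β * (K * N) := by
      refine intervalIntegral.norm_integral_le_of_norm_le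
        (f := fun x => (b - x) ^ β * besselJ ν (ω * x) * ψ x) hsb.le
        (Filter.Eventually.of_forall fun x hx => ?_)
        ((intervalIntegrable_sub_rpow hβ b s).mul_const _)
      have hcx : c ≤ x := hcs.trans hx.1.le
      have hg := Real.rpow_nonneg (show 0 ≤ b - x by linarith [hx.2]) β
      rw [norm_mul, norm_mul, Real.norm_eq_abs, Real.norm_eq_abs, Real.norm_eq_abs,
        abs_of_nonneg hg, mul_assoc]
      exact mul_le_mul_of_nonneg_left (mul_le_mul (hJK x hcx).1 (hψN x ⟨hcx, hx.2⟩)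
        (abs_nonneg _) hK0.le) hg
    rwa [intervalIntegral.integral_mul_const, integral_sub_rpow hβ,
      show b - s = 1 / ω by rw [hs]; ring] at hle
  have hsplit : ∫ x in c..b, (b - x) ^ β * besselJ ν (ω * x) * ψ x =
      (∫ x in c..s, (b - x) ^ β * ψ x * besselJ ν (ω * x)) +
        ∫ x in s..b, (b - x) ^ β * besselJ ν (ω * x) * ψ x := by
    have hsm : s ∈ uIcc c b := by rw [uIcc_of_le hcb.le]; exact ⟨hcs, hsb.le⟩
    rw [← intervalIntegral.integral_add_adjacent_intervals
      (hint.mono_set (uIcc_subset_uIcc_left hsm)) (hint.mono_set (uIcc_subset_uIcc_right hsm))]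
    congr 1
    refine intervalIntegral.integral_congr fun x _ => ?_
    ring
  have hpow : ω ^ (-min (β + 3 / 2) (3 / 2)) = ω ^ (-(1 / 2) : ℝ) * (ω ^ (-e) / ω) := by
    have : min (β + 3 / 2) (3 / 2) = e + 3 / 2 := by
      rw [he, ← min_add_add_right, zero_add]
    rw [this, ← Real.rpow_sub_one hω0.ne', ← Real.rpow_add hω0]
    congr 1
    ring
  -- As `e ≤ β` and `ω ≥ 1`, the tail is no larger than the order of the main piece.
  have htail' : (1 / ω) ^ (β + 1) ≤ ω ^ (-e) / ω := by
    rw [one_div, Real.inv_rpow hω0.le, ← Real.rpow_neg hω0.le, ← Real.rpow_sub_one hω0.ne']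
    exact Real.rpow_le_rpow_of_exponent_le hω1 (by linarith [min_le_left β 0])
  have hκs : |ν + 1| * (s - c) / c ≤ κ := by rw [hκ]; gcongr
  rw [hsplit, hpow, normWAC, ← hN, ← hN']
  refine (abs_add_le _ _).trans ?_
  calc _ ≤ K / ω * (2 * (Q * N) + (N * Q + Q * N') + κ * (Q * N)) +
        ω ^ (-e) / ω / (β + 1) * (K * N) := by
        refine add_le_add (hbody.trans ?_) (htail.trans ?_)
        · gcongr
          exact hφ'.trans (by gcongr)
        · gcongr
    _ ≤ K / ω * (Q * (3 + κ) * (N + N')) + ω ^ (-e) / ω / (β + 1) * (K * (N + N')) := by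
        gcongr
        · nlinarith [mul_nonneg hQ0 hN'0, mul_nonneg hκ0 (mul_nonneg hQ0 hN'0)]
        · linarith
    _ = _ := by
        rw [hK, hQ]
        ring
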